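/- Let $B$ be a compact connected manifold, possibly with boundary or corners, and let $G$ be a finite group. Let $\Pi_1(B)$ be the fundamental groupoid of $B$, and regard $G$ as a one-object groupoid. A flat $G$-connection on $B$ is a functor $A:\Pi_1(B)\to G$, and a gauge transformation is a natural transformation between such functors; they form the groupoid $[\Pi_1(B),G]$. Let $\mathrm{Vect}$ be the category of finite-dimensional complex vector spaces, and put $$Z_G(B)=\big[[\Pi_1(B),G],\mathrm{Vect}\big],$$ the category of functors $[\Pi_1(B),G]\to\mathrm{Vect}$. Fix $b\in B$. For a flat connection $A$ let $\mathrm{Aut}(A)$ be its group of gauge transformations $A\to A$. Then evaluation $\alpha\mapsto\alpha(b)$ is an injective homomorphism $\mathrm{Aut}(A)\to G$, so that $\mathrm{Aut}(A)$ is identified with a subgroup of $G$ (the stabilizer of $A$). The set of gauge-equivalence classes $[A]$ of flat connections is finite, and each $\mathrm{Aut}(A)$ has finitely many isomorphism classes of irreducible finite-dimensional complex representations. Moreover $Z_G(B)$ is a Kapranov–Voevodsky 2-vector space (a $\mathbb{C}$-linear category with finite biproducts in which every object is a finite biproduct of objects $x$ with $\hom(x,x)\cong\mathbb{C}$), and there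 is a $\mathbb{C}$-linear equivalence of categories $$Z_G(B)\simeq\mathrm{Vect}^n,\qquad n=\sum_{[A]}\big|\{\text{irreducible representations of }\mathrm{Aut}(A)\}/\cong\big|,$$ where the sum is over the gauge-equivalence classes of flat connections on $B$ and $A$ is any representative of $[A]$. -/

import Mathlib

open CategoryTheory CategoryTheory.Limits
open scoped Manifold ContDiff

noncomputable section

namespace ExtendedTQFT

universe u v

/-! ### Kapranov–Voevodsky 2-vector spaces -/

/-- `Vect`: finite-dimensional complex vector spaces and linear maps. -/
abbrev Vect := FGModuleCat.{0} ℂ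

/-- `Vect^n`: `n`-tuples of finite-dimensional complex vector spaces, and `n`-tuples of
linear maps. -/
abbrev VectPow (n : ℕ) := Fin n → Vect

/-- Morphisms of `Vect^n` are added componentwise. -/
instance VectPow.preadditive (n : ℕ) : Preadditive (VectPow n) where
  homGroup X Y := Pi.addCommGroup (f := fun i => X i ⟶ Y i)
  add_comp X Y Z f f' g := by
    funext i
    exact Preadditive.add_comp (X i) (Y i) (Z i) (f i) (f' i) (g i)
  comp_add X Y Z f g g' := by
    funext i
    exact Preadditive.comp_add (X i) (Y i) (Z i) (f i) (g i) (g' i)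

/-- Morphisms of `Vect^n` are multiplied by scalars componentwise. -/
instance VectPow.linear (n : ℕ) : Linear ℂ (VectPow n) where
  homModule X Y := Pi.module (Fin n) (fun i => X i ⟶ Y i) ℂ
  smul_comp X Y Z r f g := by
    funext i
    exact Linear.smul_comp (X i) (Y i) (Z i) r (f i) (g i)
  comp_smul X Y Z f r g := by
    funext i
    exact Linear.comp_smul (X i) (Y i) (Z i) (f i) r (g i)

/-- An object `x` of a `ℂ`-linear category is simple if `hom(x,x) ≅ ℂ`. -/
def IsSimpleObj {C : Type u} [Category.{v} C] [Preadditive C] [Linear ℂ C] (x : C) : Prop :=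
  Nonempty ((x ⟶ x) ≃ₗ[ℂ] ℂ)

/-- A Kapranov–Voevodsky 2-vector space: a `ℂ`-linear category with finite biproducts in which
every object is a finite biproduct of simple objects. -/
structure IsKV2VectorSpace (C : Type u) [Category.{v} C] [Preadditive C] [Linear ℂ C] : Prop where
  hasFiniteBiproducts : HasFiniteBiproducts C
  exists_simple_decomposition : ∀ X : C, ∃ (m : ℕ) (S : Fin m → C),
    (∀ i, IsSimpleObj (S i)) ∧ Nonempty (X ≅ ⨁ S)

/-! ### Flat connections and gauge transformations -/

/-- The groupoid `[Π₁(B), G]`, with `G` seen as a one-object groupoid. Its objects are the flat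
`G`-connections on `B`, its morphisms the gauge transformations. -/
abbrev FlatConnection (G : Type v) [Group G] (B : Type u) [TopologicalSpace B] :=
  FundamentalGroupoid B ⥤ SingleObj G

/-- Gauge-equivalence classes of flat connections. -/
abbrev GaugeClass (G : Type v) [Group G] (B : Type u) [TopologicalSpace B] :=
  Quotient (isIsomorphicSetoid (FlatConnection G B))

/-- The gauge-equivalence class `[A]` of a flat connection `A`. -/
def gaugeClass {G : Type v} [Group G] {B : Type u} [TopologicalSpace B]
    (A : FlatConnection G B) : GaugeClass G B :=
  Quotient.mk (isIsomorphicSetoid (FlatConnection G B)) A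

/-- `Z_G(B) = [[Π₁(B), G], Vect]`. -/
abbrev ZG (G : Type v) [Group G] (B : Type u) [TopologicalSpace B] :=
  FlatConnection G B ⥤ Vect

/-- The homomorphism `Aut(A) → G` sending a gauge transformation `α : A → A` to its value
`α(b)` at the base point `b`. -/
def gaugeEval {G : Type v} [Group G] {B : Type u} [TopologicalSpace B] (b : B)
    (A : FlatConnection G B) : Aut A →* G where
  toFun α := α.hom.app (FundamentalGroupoid.mk b)
  map_one' := rfl
  map_mul' _ _ := rfl

/-- `Aut(A)` as a subgroup of `G`: the values at the base point `b` of the gauge transformations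
that leave `A` fixed. -/
def autSubgroup {G : Type v} [Group G] {B : Type u} [TopologicalSpace B] (b : B)
    (A : FlatConnection G B) : Subgroup G :=
  (gaugeEval b A).range

/-! ### Irreducible representations -/

/-- Isomorphism classes of irreducible finite-dimensional complex representations of `K`. -/
def Irreps (K : Type v) [Group K] : Type (max 1 v) :=
  {c : Quotient (isIsomorphicSetoid (FDRep ℂ K)) //
    ∃ V : FDRep ℂ K, Representation.IsIrreducible (FDRep.ρ V) ∧ Quotient.mk _ V = c}

end ExtendedTQFT

end

/-!
# The extended TQFT of a finite group on a compact manifold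

Let `C` be the groupoid of flat `G`-connections on `B`. The theorem is the representation theory of
the groupoid `C`, once `C` is known to be essentially finite.

*Finiteness of `C`.* A gauge transformation is determined by its value at one point because `B` is
path connected, so the sets of morphisms of `C` are finite. For the gauge classes, no presentation
of the fundamental group is needed. A manifold modelled on a convex set is strongly locally
contractible, so a Lebesgue number argument gives a finite cover of `B` by contractible
neighbourhoods `N i` such that two members which meet lie in a common contractible set
(`exists_finite_contractible_cover`). Choose a centre in each `N i` and a path in `N i ∪ N j`
between the centres of any two members which meet. Two connections with the same holonomies along
these finitely many paths are gauge equivalent (`nonempty_iso_of_holonomy_eq`): transport within the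
`N i` gives a well-defined transformation, and naturality along a path follows by subdividing it
(`FundamentalGroupoid.induction_of_cover`). Hence there are finitely many gauge classes.

*Linear algebra.* A `ℂ`-linear category with finite biproducts is equivalent to `Vect^n` as soon as
it contains `n` pairwise orthogonal objects `S i` with endomorphism algebra `ℂ` such that every
identity morphism is a sum of morphisms factoring through some `S i` (`IsSimpleGenerating`). The
equivalence is `X ↦ (Hom(S i, X))ᵢ` (`homFunctor`). Full faithfulness is checked on the `S i`, and
every tuple of dimensions is attained by a biproduct of the `S i`; the same biproducts show that
the category is a Kapranov–Voevodsky 2-vector space.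

*Simple objects.* For a finite group the irreducible representations have these properties, by
Schur's lemma and Maschke's theorem (`isSimpleGenerating_irrep`). For a representative `r c` of each
isomorphism class of `C`, a representation `V` of `Aut (r c)` induces the functor which sends `A` to
the equivariant functions from the morphisms `r c ⟶ A` to `V` (`ind`). Induction is fully faithful,
functors induced from different classes are orthogonal, and averaging over `r c ⟶ A` shows that the
identity of every functor `X` is a sum, over the classes, of morphisms through functors induced from
the representations `X (r c)` (`exists_indUnit_comp`). So the functors induced from irreducible
representations have the required properties (`isSimpleGenerating_ind`), and there are `n` of them.
-/

/-! ### Local contractibility of manifolds and small covers -/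

open Topology in
theorem ModelWithCorners.stronglyLocallyContractibleSpace {E : Type*} [NormedAddCommGroup E]
    [NormedSpace ℝ E] {H : Type*} [TopologicalSpace H] (I : ModelWithCorners ℝ E H) :
    StronglyLocallyContractibleSpace H := by
  refine .of_bases (ι := ℝ) (p := fun _ r => 0 < r)
    (s := fun x r => I ⁻¹' (Metric.ball (I x) r ∩ Set.range I)) (fun x => ?_) (fun x r hr => ?_)
  · simp only [Set.preimage_inter, Set.preimage_range, Set.inter_univ]
    rw [I.isClosedEmbedding.isInducing.nhds_eq_comap]
    exact Metric.nhds_basis_ball.comap _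
  · rw [(I.isClosedEmbedding.isEmbedding.homeomorphOfSubsetRange
      Set.inter_subset_right).contractibleSpace_iff]
    exact ((convex_ball _ _).inter I.convex_range).contractibleSpace
      ⟨I x, Metric.mem_ball_self hr, Set.mem_range_self x⟩

open Topology in
theorem ChartedSpace.stronglyLocallyContractibleSpace (H : Type*) [TopologicalSpace H]
    [StronglyLocallyContractibleSpace H] (M : Type*) [TopologicalSpace M] [ChartedSpace H M] :
    StronglyLocallyContractibleSpace M := by
  refine .of_bases (p := fun x (s : Set H) => (s ∈ 𝓝 (chartAt H x x) ∧ ContractibleSpace s) ∧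
      s ⊆ (chartAt H x).target) (s := fun x s => (chartAt H x).symm '' s) (fun x => ?_) ?_
  · simpa only [OpenPartialHomeomorph.symm_map_nhds_eq, mem_chart_source, id, and_assoc] using!
      ((contractible_basis (chartAt H x x)).hasBasis_self_subset
        (chart_target_mem_nhds H x)).map (chartAt H x).symm
  · rintro x s ⟨⟨-, hs⟩, hst⟩
    exact ((chartAt H x).symm.homeomorphOfImageSubsetSource hst rfl).symm.contractibleSpace

/-- A compact Hausdorff, strongly locally contractible space has a finite cover by contractible
neighbourhoods such that the union of any two which meet is contained in a contractible set. This is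
a Lebesgue number argument for the uniform structure of a compact Hausdorff space. -/
theorem exists_finite_contractible_cover (X : Type*) [TopologicalSpace X] [CompactSpace X]
    [T2Space X] [StronglyLocallyContractibleSpace X] :
    ∃ (ι : Type) (_ : Finite ι) (N : ι → Set X), (∀ x, ∃ i, x ∈ interior (N i)) ∧
      (∀ i, ContractibleSpace (N i)) ∧
      ∀ i j, (N i ∩ N j).Nonempty → ∃ U : Set X, ContractibleSpace U ∧ N i ∪ N j ⊆ U := by
  let : UniformSpace X := uniformSpaceOfCompactR1
  have hU (x : X) : ∃ U : Set X, U ∈ nhds x ∧ ContractibleSpace U :=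
    let ⟨U, hU, _⟩ := (contractible_basis x).mem_iff.1 Filter.univ_mem
    ⟨U, hU⟩
  choose U hUx hUc using hU
  obtain ⟨V, hV, hVU⟩ := lebesgue_number_lemma_nhds (isCompact_univ (X := X)) (fun x _ => hUx x)
  obtain ⟨t₁, ht₁, -, ht₁V⟩ := comp_symm_of_uniformity hV
  obtain ⟨t₂, ht₂, ht₂s, ht₂t₁⟩ := comp_symm_of_uniformity ht₁
  have hN (x : X) : ∃ N : Set X, (N ∈ nhds x ∧ ContractibleSpace N) ∧ N ⊆ UniformSpace.ball x t₂ :=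
    (contractible_basis x).mem_iff.1 (UniformSpace.ball_mem_nhds x ht₂)
  choose N hNx hNt using hN
  obtain ⟨T, -, hT⟩ := (isCompact_univ (X := X)).elim_nhds_subcover (fun x => interior (N x))
    (fun x _ => interior_mem_nhds.2 (hNx x).1)
  let e := T.equivFin
  refine ⟨Fin T.card, inferInstance, fun i => N (e.symm i), fun x => ?_, fun i => (hNx _).2, ?_⟩
  · obtain ⟨y, hy, hxy⟩ := Set.mem_iUnion₂.1 (hT (Set.mem_univ x))
    exact ⟨e ⟨y, hy⟩, by simpa using hxy⟩
  · rintro i j ⟨z, hzi, hzj⟩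
    obtain ⟨y, hy⟩ := hVU (e.symm i) (Set.mem_univ _)
    refine ⟨U y, hUc y, fun w hw => hy ?_⟩
    have h₂₁ : t₂ ⊆ t₁ := fun p hp => ht₂t₁ ⟨p.1, refl_mem_uniformity ht₂, hp⟩
    have h₁V : t₁ ⊆ V := fun p hp => ht₁V ⟨p.1, refl_mem_uniformity ht₁, hp⟩
    rcases hw with hw | hw
    · exact h₁V (h₂₁ (hNt _ hw))
    · exact ht₁V ⟨(e.symm j : X), ht₂t₁ ⟨z, hNt _ hzi, ht₂s (hNt _ hzj)⟩, h₂₁ (hNt _ hw)⟩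

namespace FundamentalGroupoid

variable {X : Type*} [TopologicalSpace X]

/-! ### Morphisms of the fundamental groupoid supported in a subset -/

/-- A morphism of the fundamental groupoid is supported in `U` if it is the class of a path with
values in `U`. -/
def SupportedIn (U : Set X) {x y : FundamentalGroupoid X} (f : x ⟶ y) : Prop :=
  ∃ p : Path x.as y.as, Path.Homotopic.Quotient.mk p = f ∧ ∀ t, p t ∈ U

namespace SupportedIn

variable {U V : Set X} {x y z : FundamentalGroupoid X}

theorem mono (h : U ⊆ V) {f : x ⟶ y} (hf : SupportedIn U f) : SupportedIn V f :=
  let ⟨p, hp, hpU⟩ := hf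
  ⟨p, hp, fun t => h (hpU t)⟩

theorem comp {f : x ⟶ y} {g : y ⟶ z} (hf : SupportedIn U f) (hg : SupportedIn U g) :
    SupportedIn U (f ≫ g) := by
  obtain ⟨p, rfl, hp⟩ := hf
  obtain ⟨q, rfl, hq⟩ := hg
  refine ⟨p.trans q, rfl, fun t => ?_⟩
  have : p.trans q t ∈ Set.range p ∪ Set.range q := by
    rw [← Path.trans_range]; exact Set.mem_range_self t
  rcases this with ⟨s, hs⟩ | ⟨s, hs⟩
  · exact hs ▸ hp s
  · exact hs ▸ hq s

theorem source_mem {f : x ⟶ y} (hf : SupportedIn U f) : x.as ∈ U := by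
  obtain ⟨p, rfl, hp⟩ := hf
  simpa using hp 0

theorem target_mem {f : x ⟶ y} (hf : SupportedIn U f) : y.as ∈ U := by
  obtain ⟨p, rfl, hp⟩ := hf
  simpa using hp 1

theorem exists_of_pathConnected (hU : IsPathConnected U) (hx : x.as ∈ U) (hy : y.as ∈ U) :
    ∃ f : x ⟶ y, SupportedIn U f := by
  obtain ⟨p, hp⟩ := hU.joinedIn _ hx _ hy
  exact ⟨Path.Homotopic.Quotient.mk p, p, rfl, hp⟩

theorem eq_of_simplyConnected [SimplyConnectedSpace U] {f g : x ⟶ y} (hf : SupportedIn U f)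
    (hg : SupportedIn U g) : f = g := by
  obtain ⟨p, rfl, hp⟩ := hf
  obtain ⟨q, rfl, hq⟩ := hg
  let lift (r : Path x.as y.as) (hr : ∀ t, r t ∈ U) :
      Path (⟨x.as, by simpa using hr 0⟩ : U) ⟨y.as, by simpa using hr 1⟩ :=
    { toFun := fun t => ⟨r t, hr t⟩
      source' := by simp
      target' := by simp }
  exact Path.Homotopic.Quotient.eq.2
    ((SimplyConnectedSpace.paths_homotopic (lift p hp) (lift q hq)).map ⟨_, continuous_subtype_val⟩)

end SupportedIn

open scoped unitInterval in
/-- A property of morphisms of the fundamental groupoid holds for all of them if it is closed under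
composition and holds for the morphisms supported in a member of a given open cover. -/
theorem induction_of_cover {ι : Type*} {N : ι → Set X} (hN : ∀ x, ∃ i, x ∈ interior (N i))
    (P : ∀ ⦃x y : FundamentalGroupoid X⦄, (x ⟶ y) → Prop)
    (hcomp : ∀ ⦃x y z⦄ (f : x ⟶ y) (g : y ⟶ z), P f → P g → P (f ≫ g))
    (hloc : ∀ i ⦃x y⦄ (f : x ⟶ y), SupportedIn (N i) f → P f)
    {x y : FundamentalGroupoid X} (f : x ⟶ y) : P f := by
  obtain ⟨p, rfl⟩ := Path.Homotopic.Quotient.mk_surjective f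
  obtain ⟨t, ht0, htm, ⟨n, hn⟩, ht⟩ := exists_monotone_Icc_subset_open_cover_unitInterval
    (c := fun i => p ⁻¹' interior (N i)) (fun i => isOpen_interior.preimage p.continuous)
    (fun s _ => Set.mem_iUnion.2 (hN (p s)))
  let q (r s : I) : FundamentalGroupoid.mk (p r) ⟶ FundamentalGroupoid.mk (p s) :=
    Path.Homotopic.Quotient.mk (p.subpath r s)
  have hcat (r s u : I) : q r s ≫ q s u = q r u :=
    Path.Homotopic.Quotient.eq.2 ⟨Path.Homotopy.subpathTransSubpath p r s u⟩
  have hstep (k : ℕ) : P (q (t k) (t (k + 1))) := by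
    obtain ⟨i, hi⟩ := ht k
    refine hloc i _ ⟨_, rfl, fun s => ?_⟩
    have hs : p.subpath (t k) (t (k + 1)) s ∈ p '' Set.Icc (t k) (t (k + 1)) := by
      rw [← Path.range_subpath_of_le _ _ _ (htm k.le_succ)]
      exact Set.mem_range_self s
    obtain ⟨u, hu, hus⟩ := hs
    exact hus ▸ interior_subset (hi hu)
  have hind (k : ℕ) : P (q (t 0) (t (k + 1))) := by
    induction k with
    | zero => exact hstep 0
    | succ k ih => exact hcat _ (t (k + 1)) _ ▸ hcomp _ _ ih (hstep (k + 1))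
  have h01 : P (q 0 1) := by
    have := hind n
    rwa [ht0, hn _ n.le_succ] at this
  have hcast {a b a' b' : X} (r : Path a b) (ha : a' = a) (hb : b' = b)
      (h : P (x := ⟨a'⟩) (y := ⟨b'⟩) (Path.Homotopic.Quotient.mk (r.cast ha hb))) :
      P (x := ⟨a⟩) (y := ⟨b⟩) (Path.Homotopic.Quotient.mk r) := by
    subst ha hb
    exact h
  exact hcast p p.source p.target (p.subpath_zero_one ▸ h01)

end FundamentalGroupoid

namespace ExtendedTQFT

open FundamentalGroupoid

/-! ### Gauge classes of flat connections -/

section Finiteness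

variable {G : Type*} [Group G] {X : Type*} [TopologicalSpace X]

instance : IsGroupoid (FlatConnection G X) where
  all_isIso _ := NatIso.isIso_of_isIso_app _

theorem gaugeTransformation_ext [PathConnectedSpace X] (b : X) {A A' : FlatConnection G X}
    {α β : A ⟶ A'} (h : α.app (FundamentalGroupoid.mk b) = β.app (FundamentalGroupoid.mk b)) :
    α = β := by
  ext x
  let f : FundamentalGroupoid.mk b ⟶ x :=
    Path.Homotopic.Quotient.mk (PathConnectedSpace.somePath b x.as)
  rw [← cancel_epi (A.map f), α.naturality, β.naturality, h]

theorem gaugeEval_injective [PathConnectedSpace X] (b : X) (A : FlatConnection G X) :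
    Function.Injective (gaugeEval b A) := fun _ _ h =>
  Iso.ext (gaugeTransformation_ext b h)

theorem finite_gaugeTransformation [PathConnectedSpace X] [Nonempty X] [Finite G]
    (A A' : FlatConnection G X) : Finite (A ⟶ A') :=
  Finite.of_injective
    (fun α : A ⟶ A' => (α.app (FundamentalGroupoid.mk (Classical.arbitrary X)) : G))
    fun _ _ h => gaugeTransformation_ext _ h

/-- If the holonomies of two flat connections agree on a morphism `γ i j` inside `N i ∪ N j` for
each two members of the cover which meet, then the connections are gauge equivalent. A gauge
transformation at `x ∈ N i` compares the transports from the centre `c i` to `x` within `N i`; the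
hypotheses make it independent of `i` and of the path. -/
theorem nonempty_iso_of_holonomy_eq {ι : Type*} {N : ι → Set X}
    (hN : ∀ x, ∃ i, x ∈ interior (N i)) (hNc : ∀ i, IsPathConnected (N i))
    (hU : ∀ i j, (N i ∩ N j).Nonempty → ∃ U : Set X, SimplyConnectedSpace U ∧ N i ∪ N j ⊆ U)
    {c : ι → FundamentalGroupoid X} (hc : ∀ i, (c i).as ∈ N i) {γ : ∀ i j, c i ⟶ c j}
    (hγ : ∀ i j, (N i ∩ N j).Nonempty → SupportedIn (N i ∪ N j) (γ i j))
    {A A' : FlatConnection G X} (h : ∀ i j, (A.map (γ i j) : G) = A'.map (γ i j)) :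
    Nonempty (A ≅ A') := by
  choose i hi using fun x : FundamentalGroupoid X => hN x.as
  have hi' (x) : x.as ∈ N (i x) := interior_subset (hi x)
  choose δ hδ using fun x => SupportedIn.exists_of_pathConnected (hNc (i x)) (hc (i x)) (hi' x)
  -- `τ` compares the transports of `A` and `A'` along a morphism.
  let τ {x y : FundamentalGroupoid X} (f : x ⟶ y) : G := (A'.map f : G) * (A.map f : G)⁻¹
  have hτ (j : ι) {x : FundamentalGroupoid X} (ε : c j ⟶ x) (hε : SupportedIn (N j) ε) :
      τ ε = τ (δ x) := by
    have hne : (N j ∩ N (i x)).Nonempty := ⟨x.as, hε.target_mem, hi' x⟩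
    obtain ⟨U, hUs, hU⟩ := hU _ _ hne
    have : ε = γ j (i x) ≫ δ x :=
      (hε.mono (Set.subset_union_left.trans hU)).eq_of_simplyConnected
        (((hγ _ _ hne).mono hU).comp ((hδ x).mono (Set.subset_union_right.trans hU)))
    simp only [τ, this, Functor.map_comp, SingleObj.comp_as_mul, h]
    group
  have hnat {x y : FundamentalGroupoid X} (f : x ⟶ y) :
      τ (δ y) * (A.map f : G) = (A'.map f : G) * τ (δ x) := by
    refine induction_of_cover hN (fun x y f => τ (δ y) * (A.map f : G) = (A'.map f : G) * τ (δ x))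
      (fun x y z f g hf hg => ?_) (fun j x y f hf => ?_) f
    · simp only [Functor.map_comp, SingleObj.comp_as_mul]
      rw [← mul_assoc, hg, mul_assoc, hf, mul_assoc]
    · obtain ⟨ε, hε⟩ := SupportedIn.exists_of_pathConnected (hNc j) (hc j) hf.source_mem
      rw [← hτ j ε hε, ← hτ j (ε ≫ f) (hε.comp hf)]
      simp only [τ, Functor.map_comp, SingleObj.comp_as_mul]
      group
  let η : A ⟶ A' := { app := fun x => τ (δ x), naturality := fun x y f => hnat f }
  exact ⟨asIso η⟩

/-- A compact Hausdorff, locally contractible space carries finitely many flat connections with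
finite gauge group up to gauge equivalence: they are determined by the finitely many holonomies of
`nonempty_iso_of_holonomy_eq` for a cover as in `exists_finite_contractible_cover`. -/
theorem finite_gaugeClass [Finite G] [CompactSpace X] [T2Space X]
    [StronglyLocallyContractibleSpace X] [PathConnectedSpace X] : Finite (GaugeClass G X) := by
  obtain ⟨ι, _, N, hN, hNc, hU⟩ := exists_finite_contractible_cover X
  have hNp (i) : IsPathConnected (N i) := by
    have := hNc i
    rw [isPathConnected_iff_pathConnectedSpace]
    infer_instance
  choose c hc using fun i => (hNp i).nonempty
  have hγ (i j : ι) : ∃ γ : FundamentalGroupoid.mk (c i) ⟶ FundamentalGroupoid.mk (c j),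
      (N i ∩ N j).Nonempty → SupportedIn (N i ∪ N j) γ := by
    by_cases hne : (N i ∩ N j).Nonempty
    · obtain ⟨γ, hγ⟩ := SupportedIn.exists_of_pathConnected ((hNp i).union (hNp j) hne)
        (x := FundamentalGroupoid.mk (c i)) (y := FundamentalGroupoid.mk (c j))
        (.inl (hc i)) (.inr (hc j))
      exact ⟨γ, fun _ => hγ⟩
    · exact ⟨Path.Homotopic.Quotient.mk (PathConnectedSpace.somePath _ _), fun h => (hne h).elim⟩
  choose γ hγ using hγ
  refine Finite.of_injective (β := ι → ι → G) (fun a i j => (a.out.map (γ i j) : G)) ?_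
  intro a a' h
  rw [← Quotient.out_eq a, ← Quotient.out_eq a']
  refine Quotient.sound (nonempty_iso_of_holonomy_eq hN hNp (fun i j hne => ?_) hc hγ
    fun i j => congr_fun (congr_fun h i) j)
  obtain ⟨U, hUc, hU⟩ := hU i j hne
  exact ⟨U, inferInstance, hU⟩

end Finiteness

/-! ### Finite-dimensional vector spaces -/

section Vect

/-- Morphisms of `Vect` are linear maps. -/
def vectHomEquiv (V W : Vect) : (V ⟶ W) ≃ₗ[ℂ] (V →ₗ[ℂ] W) where
  toFun f := f.hom.hom
  invFun f := FGModuleCat.ofHom f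
  map_add' _ _ := rfl
  map_smul' _ _ := rfl

theorem vectHomEquiv_comp {U V W : Vect} (f : U ⟶ V) (g : V ⟶ W) :
    vectHomEquiv U W (f ≫ g) = vectHomEquiv V W g ∘ₗ vectHomEquiv U V f := rfl

variable (M : Type*) [AddCommGroup M] [Module ℂ M] [Module.Finite ℂ M]

theorem exists_vectCopy : ∃ W : Vect, Nonempty (W ≃ₗ[ℂ] M) := by
  have := Module.Finite.small.{0} ℂ M
  exact ⟨FGModuleCat.of ℂ (Shrink.{0} M), ⟨Shrink.linearEquiv ℂ M⟩⟩

/-- A copy in `Vect`, hence in `Type`, of a finite-dimensional vector space in any universe. -/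
noncomputable def vectCopy : Vect := (exists_vectCopy M).choose

/-- The identification of a vector space with its copy in `Vect`. -/
noncomputable def vectCopyEquiv : vectCopy M ≃ₗ[ℂ] M := (exists_vectCopy M).choose_spec.some

end Vect

/-! ### Linear categories generated by pairwise orthogonal simple objects -/

section Semisimple

universe w u₁ v₁

variable {D : Type u₁} [Category.{v₁} D] [Preadditive D] [Linear ℂ D]

/-- The linear span of the morphisms `X ⟶ Y` which factor through a member of the family `S`. -/
def factorSpan {ι : Type w} (S : ι → D) (X Y : D) : Submodule ℂ (X ⟶ Y) :=
  Submodule.span ℂ {f | ∃ (i : ι) (p : X ⟶ S i) (q : S i ⟶ Y), p ≫ q = f}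

variable {ι : Type w} {S : ι → D}

theorem comp_mem_factorSpan {X Y : D} {i : ι} (p : X ⟶ S i) (q : S i ⟶ Y) :
    p ≫ q ∈ factorSpan S X Y :=
  Submodule.subset_span ⟨i, p, q, rfl⟩

theorem comp_left_mem_factorSpan {X Y Z : D} (f : X ⟶ Y) {g : Y ⟶ Z}
    (hg : g ∈ factorSpan S Y Z) : f ≫ g ∈ factorSpan S X Z := by
  induction hg using Submodule.span_induction with
  | mem g hg =>
    obtain ⟨i, p, q, rfl⟩ := hg
    rw [← Category.assoc]
    exact comp_mem_factorSpan _ _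
  | zero => simp
  | add g h _ _ hg hh => rw [Preadditive.comp_add]; exact add_mem hg hh
  | smul r g _ hg => rw [Linear.comp_smul]; exact Submodule.smul_mem _ _ hg

theorem comp_right_mem_factorSpan {X Y Z : D} {f : X ⟶ Y} (hf : f ∈ factorSpan S X Y)
    (g : Y ⟶ Z) : f ≫ g ∈ factorSpan S X Z := by
  induction hf using Submodule.span_induction with
  | mem f hf =>
    obtain ⟨i, p, q, rfl⟩ := hf
    rw [Category.assoc]
    exact comp_mem_factorSpan _ _
  | zero => simp
  | add f h _ _ hf hh => rw [Preadditive.add_comp]; exact add_mem hf hh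
  | smul r f _ hf => rw [Linear.smul_comp]; exact Submodule.smul_mem _ _ hf

variable (S) in
/-- `S` is a family of pairwise orthogonal simple objects generating `D`, in the sense that every
identity is a sum of morphisms which factor through members of `S`. -/
structure IsSimpleGenerating : Prop where
  isSimpleObj : ∀ i, IsSimpleObj (S i)
  hom_eq_zero : ∀ {i j}, i ≠ j → ∀ f : S i ⟶ S j, f = 0
  id_mem : ∀ X : D, 𝟙 X ∈ factorSpan S X X

theorem IsSimpleObj.exists_smul_id {X : D} (hX : IsSimpleObj X) (f : X ⟶ X) :
    ∃ c : ℂ, f = c • 𝟙 X := by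
  obtain ⟨e⟩ := hX
  have h1 : e (𝟙 X) ≠ 0 := by
    intro h
    have h0 : 𝟙 X = 0 := e.injective (by simpa using h)
    have hX : e.symm 1 = 0 := by rw [← Category.comp_id (e.symm 1), h0, comp_zero]
    simp at hX
  refine ⟨e f / e (𝟙 X), e.injective ?_⟩
  simp [h1]

namespace IsSimpleGenerating

variable (hS : IsSimpleGenerating S)
include hS

theorem exists_sum_eq_id (X : D) : ∃ (m : ℕ) (f : Fin m → ι) (p : ∀ k, X ⟶ S (f k))
    (q : ∀ k, S (f k) ⟶ X), ∑ k, p k ≫ q k = 𝟙 X := by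
  obtain ⟨m, c, g, hg⟩ := (Submodule.mem_span_set' ).1 (hS.id_mem X)
  choose f p q h using fun k => (g k).2
  exact ⟨m, f, fun k => c k • p k, q, by simpa [h] using hg⟩

/-- Morphisms out of `X` are determined by their composites with the morphisms `S i ⟶ X`. -/
theorem hom_ext {X Y : D} {f g : X ⟶ Y} (h : ∀ i (s : S i ⟶ X), s ≫ f = s ≫ g) : f = g := by
  obtain ⟨m, l, p, q, hpq⟩ := hS.exists_sum_eq_id X
  rw [← Category.id_comp f, ← Category.id_comp g, ← hpq]
  simp [Preadditive.sum_comp, h]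

/-- Every family of linear maps `Hom(S i, X) → Hom(S i, Y)` comes from a morphism `X ⟶ Y`: it is
automatically natural in `i`, as the only morphisms between the `S i` are scalars. -/
theorem exists_hom {X Y : D} (φ : ∀ i, (S i ⟶ X) →ₗ[ℂ] (S i ⟶ Y)) :
    ∃ f : X ⟶ Y, ∀ i (s : S i ⟶ X), s ≫ f = φ i s := by
  obtain ⟨m, l, p, q, hpq⟩ := hS.exists_sum_eq_id X
  refine ⟨∑ k, p k ≫ φ (l k) (q k), fun i s => ?_⟩
  conv_rhs => rw [← Category.comp_id s, ← hpq]
  rw [Preadditive.comp_sum, Preadditive.comp_sum, map_sum]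
  refine Finset.sum_congr rfl fun k _ => ?_
  rw [← Category.assoc, ← Category.assoc]
  generalize s ≫ p k = r
  generalize q k = t
  generalize l k = j at r t
  by_cases hij : i = j
  · subst hij
    obtain ⟨c, rfl⟩ := (hS.isSimpleObj i).exists_smul_id r
    simp
  · simp [hS.hom_eq_zero hij r]

theorem finite_hom (i : ι) (X : D) : Module.Finite ℂ (S i ⟶ X) := by
  obtain ⟨m, l, p, q, hpq⟩ := hS.exists_sum_eq_id X
  have hfin (j : ι) : Module.Finite ℂ (S i ⟶ S j) := by
    by_cases hij : i = j
    · subst hij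
      obtain ⟨e⟩ := hS.isSimpleObj i
      exact .equiv e.symm
    · have : Subsingleton (S i ⟶ S j) :=
        ⟨fun f g => (hS.hom_eq_zero hij f).trans (hS.hom_eq_zero hij g).symm⟩
      infer_instance
  refine .of_injective (N := ∀ k, S i ⟶ S (l k)) (LinearMap.pi fun k => Linear.rightComp ℂ _ (p k))
    fun f g hfg => ?_
  rw [← Category.comp_id f, ← Category.comp_id g, ← hpq, Preadditive.comp_sum,
    Preadditive.comp_sum]
  refine Finset.sum_congr rfl fun k _ => ?_
  rw [← Category.assoc, ← Category.assoc]
  exact congr_arg (· ≫ q k) (congr_fun hfg k)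

theorem finrank_hom [DecidableEq ι] (i j : ι) :
    Module.finrank ℂ (S i ⟶ S j) = if i = j then 1 else 0 := by
  split_ifs with hij
  · subst hij
    obtain ⟨e⟩ := hS.isSimpleObj i
    rw [e.finrank_eq, Module.finrank_self]
  · have : Subsingleton (S i ⟶ S j) :=
      ⟨fun f g => (hS.hom_eq_zero hij f).trans (hS.hom_eq_zero hij g).symm⟩
    exact Module.finrank_zero_of_subsingleton

theorem finrank_hom_biproduct [DecidableEq ι] [HasFiniteBiproducts D] {κ : Type} [Fintype κ]
    (l : κ → ι) (i : ι) :
    Module.finrank ℂ (S i ⟶ ⨁ fun k => S (l k)) = Fintype.card {k // l k = i} := by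
  let e : (S i ⟶ ⨁ fun k => S (l k)) ≃ₗ[ℂ] ∀ k, S i ⟶ S (l k) :=
    { toFun := fun s k => s ≫ biproduct.π _ k
      invFun := fun s => biproduct.lift s
      map_add' := by intros; ext; simp
      map_smul' := by intros; ext; simp
      left_inv := fun s => by ext; simp
      right_inv := fun s => by ext; simp }
  have := hS.finite_hom
  rw [e.finrank_eq, Module.finrank_pi_fintype, Fintype.card_subtype, Finset.card_filter]
  exact Finset.sum_congr rfl fun k _ => by simp only [hS.finrank_hom, eq_comm]

end IsSimpleGenerating

section Coordinates

variable {n : ℕ} {S : Fin n → D} (hS : IsSimpleGenerating S)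

/-- The vector space `Hom(S i, X)`, replaced by a copy in `Type`. -/
noncomputable def homObj (X : D) : VectPow n := fun i =>
  haveI := hS.finite_hom i X
  vectCopy (S i ⟶ X)

/-- The identification of `homObj` with the space of morphisms. -/
noncomputable def homObjEquiv (X : D) (i : Fin n) : homObj hS X i ≃ₗ[ℂ] (S i ⟶ X) :=
  haveI := hS.finite_hom i X
  vectCopyEquiv (S i ⟶ X)

/-- Morphisms of `Vect^n` between the tuples `(Hom(S i, X))ᵢ` and `(Hom(S i, Y))ᵢ` are families of
linear maps. -/
noncomputable def homObjHomEquiv (X Y : D) :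
    (homObj hS X ⟶ homObj hS Y) ≃ₗ[ℂ] ∀ i, (S i ⟶ X) →ₗ[ℂ] (S i ⟶ Y) where
  toFun φ i := (homObjEquiv hS X i).arrowCongr (homObjEquiv hS Y i) (vectHomEquiv _ _ (φ i))
  invFun φ i := (vectHomEquiv _ _).symm
    (((homObjEquiv hS X i).arrowCongr (homObjEquiv hS Y i)).symm (φ i))
  left_inv φ := by funext i; simp
  right_inv φ := by funext i; simp
  map_add' φ ψ := funext fun i =>
    map_add ((vectHomEquiv _ _).trans ((homObjEquiv hS X i).arrowCongr (homObjEquiv hS Y i)))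
      (φ i) (ψ i)
  map_smul' r φ := funext fun i =>
    map_smul ((vectHomEquiv _ _).trans ((homObjEquiv hS X i).arrowCongr (homObjEquiv hS Y i)))
      r (φ i)

theorem homObjHomEquiv_id (X : D) : homObjHomEquiv hS X X (𝟙 _) = fun _ => LinearMap.id := by
  funext i
  ext s
  exact (homObjEquiv hS X i).apply_symm_apply s

theorem homObjHomEquiv_comp {X Y Z : D} (φ : homObj hS X ⟶ homObj hS Y)
    (ψ : homObj hS Y ⟶ homObj hS Z) : homObjHomEquiv hS X Z (φ ≫ ψ) =
      fun i => homObjHomEquiv hS Y Z ψ i ∘ₗ homObjHomEquiv hS X Y φ i := by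
  funext i
  ext s
  refine congr_arg (homObjEquiv hS Z i) (congr_arg (vectHomEquiv _ _ (ψ i)) ?_)
  exact ((homObjEquiv hS Y i).symm_apply_apply _).symm

/-- The functor `D ⥤ Vect^n` with components `X ↦ Hom(S i, X)`. -/
noncomputable def homFunctor : D ⥤ VectPow n where
  obj X := homObj hS X
  map {X Y} f := (homObjHomEquiv hS X Y).symm fun i => Linear.rightComp ℂ (S i) f
  map_id X := by
    rw [LinearEquiv.symm_apply_eq, homObjHomEquiv_id]
    funext i
    ext s
    simp
  map_comp {X Y Z} f g := by
    rw [LinearEquiv.symm_apply_eq, homObjHomEquiv_comp]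
    funext i
    ext s
    simp

instance : (homFunctor hS).Additive where
  map_add {X Y f g} := by
    refine Eq.trans (congr_arg (homObjHomEquiv hS X Y).symm ?_)
      (map_add (homObjHomEquiv hS X Y).symm _ _)
    funext i
    ext s
    simp

instance : (homFunctor hS).Linear ℂ where
  map_smul {X Y} f r := by
    refine Eq.trans (congr_arg (homObjHomEquiv hS X Y).symm ?_)
      (map_smul (homObjHomEquiv hS X Y).symm _ _)
    funext i
    ext s
    simp

instance : (homFunctor hS).Faithful where
  map_injective {X Y _ _} h := hS.hom_ext fun i s =>
    LinearMap.congr_fun (congr_fun ((homObjHomEquiv hS X Y).symm.injective h) i) s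

instance : (homFunctor hS).Full where
  map_surjective {X Y} φ := by
    obtain ⟨f, hf⟩ := hS.exists_hom (homObjHomEquiv hS X Y φ)
    refine ⟨f, (LinearEquiv.symm_apply_eq _).2 ?_⟩
    funext i
    ext s
    exact hf i s

variable [HasFiniteBiproducts D]

/-- Every object of `Vect^n` is the image of a finite biproduct of members of `S`, as only the
dimensions of its components matter. -/
theorem exists_biproduct_iso (W : VectPow n) : ∃ (m : ℕ) (l : Fin m → Fin n),
    Nonempty ((homFunctor hS).obj (⨁ fun k => S (l k)) ≅ W) := by
  let d (i : Fin n) : ℕ := Module.finrank ℂ (W i)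
  let l (k : Fin (∑ i, d i)) : Fin n := (finSigmaFinEquiv.symm k).1
  refine ⟨_, l, ⟨Pi.isoMk fun i => ?_⟩⟩
  have hl : Fintype.card {k // l k = i} = d i := by
    rw [Fintype.card_congr (((finSigmaFinEquiv (n := d)).symm.subtypeEquiv
      (q := fun x => x.1 = i) fun _ => Iff.rfl).trans (Equiv.sigmaSubtype i))]
    simp
  have h : Module.finrank ℂ (homObj hS (⨁ fun k => S (l k)) i) = Module.finrank ℂ (W i) := by
    rw [(homObjEquiv hS _ i).finrank_eq, hS.finrank_hom_biproduct, hl]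
  exact (LinearEquiv.ofFinrankEq _ _ h).toFGModuleCatIso

instance : (homFunctor hS).EssSurj where
  mem_essImage W :=
    let ⟨_, _, h⟩ := exists_biproduct_iso hS W
    ⟨_, h⟩

instance : (homFunctor hS).IsEquivalence where

include hS in
/-- A linear category generated by `n` pairwise orthogonal simple objects is equivalent to
`Vect^n`. -/
theorem IsSimpleGenerating.exists_equivalence :
    ∃ e : D ≌ VectPow n, e.functor.Additive ∧ e.functor.Linear ℂ :=
  ⟨(homFunctor hS).asEquivalence, inferInstanceAs (homFunctor hS).Additive,
    inferInstanceAs ((homFunctor hS).Linear ℂ)⟩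

include hS in
theorem IsSimpleGenerating.isKV2VectorSpace : IsKV2VectorSpace D where
  hasFiniteBiproducts := inferInstance
  exists_simple_decomposition X := by
    obtain ⟨m, l, ⟨e⟩⟩ := exists_biproduct_iso hS ((homFunctor hS).obj X)
    exact ⟨m, fun k => S (l k), fun k => hS.isSimpleObj _, ⟨(homFunctor hS).preimageIso e.symm⟩⟩

end Coordinates
end Semisimple

/-! ### Complex representations of a finite group -/

section Representations

universe v
variable {K : Type v} [Group K]

/-- Morphisms of `FDRep ℂ K` are intertwining maps. -/
noncomputable def fdRepHomEquiv (V W : FDRep ℂ K) :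
    (V ⟶ W) ≃ₗ[ℂ] Representation.IntertwiningMap V.ρ W.ρ where
  toFun f := ⟨f.hom.hom.hom, fun g => congr_arg (fun h => h.hom.hom) (f.comm g)⟩
  invFun f := ⟨FGModuleCat.ofHom f.toLinearMap, fun g =>
    FGModuleCat.hom_ext (f.isIntertwining' g)⟩
  map_add' _ _ := rfl
  map_smul' _ _ := rfl

/-- Isomorphisms of `FDRep ℂ K` from equivalences of representations. -/
noncomputable def fdRepIso {V W : FDRep ℂ K} (e : Representation.Equiv V.ρ W.ρ) : V ≅ W where
  hom := (fdRepHomEquiv V W).symm e.toIntertwiningMap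
  inv := (fdRepHomEquiv W V).symm e.symm.toIntertwiningMap
  hom_inv_id := by
    refine (fdRepHomEquiv V V).injective ?_
    ext x
    exact e.symm_apply_apply x
  inv_hom_id := by
    refine (fdRepHomEquiv W W).injective ?_
    ext x
    exact e.apply_symm_apply x

/-- A representation in each isomorphism class of irreducible representations. -/
noncomputable def irrep (c : Irreps K) : FDRep ℂ K := c.2.choose

instance isIrreducible_irrep (c : Irreps K) : Representation.IsIrreducible (irrep c).ρ :=
  c.2.choose_spec.1

theorem mk_irrep (c : Irreps K) :
    Quotient.mk (isIsomorphicSetoid (FDRep ℂ K)) (irrep c) = c.1 :=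
  c.2.choose_spec.2

theorem isEmpty_equiv_irrep {c d : Irreps K} (h : c ≠ d) :
    IsEmpty (Representation.Equiv (irrep c).ρ (irrep d).ρ) :=
  ⟨fun e => h <| Subtype.ext <| by
    rw [← mk_irrep, ← mk_irrep]
    exact Quotient.sound ⟨fdRepIso e⟩⟩

theorem exists_iso_irrep (V : FDRep ℂ K) (hV : Representation.IsIrreducible V.ρ) :
    ∃ c, Nonempty (V ≅ irrep c) :=
  let c : Irreps K := ⟨Quotient.mk _ V, V, hV, rfl⟩
  ⟨c, Quotient.exact (mk_irrep c).symm⟩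

variable [Finite K]

/-- The characters of pairwise non-isomorphic irreducible representations are linearly independent
functions on the group. -/
instance finite_irreps : Finite (Irreps K) := by
  classical
  have := Fintype.ofFinite K
  have : Invertible (Nat.card K : ℂ) := invertibleOfNonzero (by simp)
  let χ (c : Irreps K) : K → ℂ := Representation.character (irrep c).ρ
  let f (c : Irreps K) : Module.Dual ℂ (K → ℂ) :=
    (Nat.card K : ℂ)⁻¹ • ∑ g : K, χ c g⁻¹ • LinearMap.proj g
  have hf (c d : Irreps K) : f c (χ d) =
      if Nonempty (Representation.Equiv (irrep c).ρ (irrep d).ρ) then 1 else 0 := by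
    rw [← Representation.char_orthonormal]
    simp [f, χ, mul_comm]
  have hχ : LinearIndependent ℂ χ := by
    refine .of_pairwise_dual_eq_zero_one _ f (fun c d hcd => ?_) fun c => ?_
    · exact (hf c d).trans (if_neg (not_nonempty_iff.2 (isEmpty_equiv_irrep hcd)))
    · exact (hf c c).trans (if_pos ⟨.refl _⟩)
  exact hχ.finite

/-- Complete reducibility: the identity of every finite-dimensional representation is a sum of
morphisms through irreducible ones, by induction on the dimension from Maschke's theorem. -/
theorem id_mem_factorSpan_irrep (V : FDRep ℂ K) : 𝟙 V ∈ factorSpan (irrep (K := K)) V V := by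
  induction hn : Module.finrank ℂ V using Nat.strong_induction_on generalizing V with
  | _ n ih =>
  subst hn
  by_cases hV : Representation.IsIrreducible V.ρ
  · obtain ⟨c, ⟨e⟩⟩ := exists_iso_irrep V hV
    rw [← e.hom_inv_id]
    exact comp_mem_factorSpan _ _
  by_cases hs : Subsingleton V
  · have : 𝟙 V = 0 := (fdRepHomEquiv V V).injective (by ext x; exact hs.elim _ _)
    rw [this]
    exact zero_mem _
  obtain ⟨P, hP0, hP1⟩ : ∃ P : Subrepresentation V.ρ, P ≠ ⊥ ∧ P ≠ ⊤ := by
    by_contra! h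
    have : Nontrivial V := not_subsingleton_iff_nontrivial.1 hs
    refine hV { exists_pair_ne := ⟨⊥, ⊤, fun h => ?_⟩, eq_bot_or_eq_top := fun P => ?_ }
    · exact bot_ne_top (congr_arg Subrepresentation.toSubmodule h)
    · exact or_iff_not_imp_left.2 (h P)
  obtain ⟨Q, hPQ⟩ := exists_isCompl P
  have hc : IsCompl P.toSubmodule Q.toSubmodule :=
    ⟨disjoint_iff.2 (congr_arg Subrepresentation.toSubmodule (disjoint_iff.1 hPQ.1)),
      codisjoint_iff.2 (congr_arg Subrepresentation.toSubmodule (codisjoint_iff.1 hPQ.2))⟩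
  have hP0' : P.toSubmodule ≠ ⊥ := fun h => hP0 (Subrepresentation.toSubmodule_injective h)
  have hP1' : P.toSubmodule ≠ ⊤ := fun h => hP1 (Subrepresentation.toSubmodule_injective h)
  -- The projection to `P` along `Q` is equivariant, and factors through a smaller representation.
  have key (P Q : Subrepresentation V.ρ) (hc : IsCompl P.toSubmodule Q.toSubmodule)
      (hP : P.toSubmodule ≠ ⊤) : ∃ f : V ⟶ V, f ∈ factorSpan (irrep (K := K)) V V ∧
        ∀ x, fdRepHomEquiv V V f x = P.toSubmodule.projection _ hc x := by
    let V' : FDRep ℂ K := FDRep.of P.toRepresentation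
    let i : V' ⟶ V := (fdRepHomEquiv V' V).symm ⟨P.toSubmodule.subtype, fun g => rfl⟩
    let p : V ⟶ V' := (fdRepHomEquiv V V').symm ⟨P.toSubmodule.projectionOnto _ hc, fun g => by
      ext x
      obtain ⟨y, z, rfl⟩ : ∃ (y : P.toSubmodule) (z : Q.toSubmodule), (y : V) + z = x :=
        ⟨_, _, Submodule.projection_add_projection_eq_self hc x⟩
      have hy := Submodule.projection_apply_of_mem_left hc (P.apply_mem_toSubmodule g y.2)
      have hz := (Submodule.projection_apply_eq_zero_iff hc).2 (Q.apply_mem_toSubmodule g z.2)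
      have hy' := Submodule.projection_apply_left hc y
      have hz' := Submodule.projection_apply_right hc z
      change P.toSubmodule.projection _ hc (V.ρ g (y + z)) =
        V.ρ g (P.toSubmodule.projection _ hc (y + z))
      rw [map_add, map_add, map_add, hy, hz, hy', hz', add_zero, add_zero]⟩
    refine ⟨p ≫ i, ?_, fun x => rfl⟩
    rw [← Category.comp_id p, Category.assoc]
    exact comp_left_mem_factorSpan _ (comp_right_mem_factorSpan
      (ih _ (Submodule.finrank_lt hP) V' rfl) _)
  obtain ⟨f, hf, hf'⟩ := key P Q hc hP1'
  obtain ⟨g, hg, hg'⟩ := key Q P hc.symm fun h => hP0' (by simpa [h] using hc.disjoint.eq_bot)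
  have : 𝟙 V = f + g := (fdRepHomEquiv V V).injective (by
    ext x
    rw [map_add]
    refine Eq.trans ?_ (congr_arg₂ (· + ·) (hf' x).symm (hg' x).symm)
    exact (Submodule.projection_add_projection_eq_self hc x).symm)
  rw [this]
  exact add_mem hf hg

/-- The irreducible representations form a complete system of simple objects, by Schur's lemma and
complete reducibility. -/
theorem isSimpleGenerating_irrep : IsSimpleGenerating (irrep (K := K)) where
  isSimpleObj c := ⟨(fdRepHomEquiv _ _).trans (LinearEquiv.ofBijective
    (Algebra.linearMap ℂ (Representation.IntertwiningMap (irrep c).ρ (irrep c).ρ))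
      Representation.IsIrreducible.algebraMap_intertwiningMap_bijective_of_isAlgClosed).symm⟩
  hom_eq_zero {c d} h f := by
    have := isEmpty_equiv_irrep h
    exact (fdRepHomEquiv _ _).injective (Subsingleton.elim _ _)
  id_mem := id_mem_factorSpan_irrep

end Representations

/-! ### Functors to `Vect` -/

section NatTrans

universe u w
variable {C : Type u} [Category.{w} C]

/-- A natural transformation of functors to `Vect`, from linear maps. -/
noncomputable def natTransMk {F F' : C ⥤ Vect} (τ : ∀ A, F.obj A →ₗ[ℂ] F'.obj A)
    (h : ∀ {A A'} (ψ : A ⟶ A') (x : F.obj A), τ A' (vectHomEquiv _ _ (F.map ψ) x) =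
      vectHomEquiv _ _ (F'.map ψ) (τ A x)) : F ⟶ F' where
  app A := (vectHomEquiv _ _).symm (τ A)
  naturality A A' ψ := by
    refine (vectHomEquiv _ _).injective ?_
    ext x
    exact h ψ x

theorem natTransMk_app {F F' : C ⥤ Vect} (τ : ∀ A, F.obj A →ₗ[ℂ] F'.obj A) (h) (A : C)
    (x : F.obj A) : vectHomEquiv _ _ ((natTransMk (F := F) (F' := F') τ h).app A) x = τ A x := rfl

theorem natTrans_vect_ext {F F' : C ⥤ Vect} {α β : F ⟶ F'}
    (h : ∀ A x, vectHomEquiv _ _ (α.app A) x = vectHomEquiv _ _ (β.app A) x) : α = β := by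
  ext A : 2
  refine (vectHomEquiv _ _).injective ?_
  ext x
  exact h A x

theorem natTrans_naturality {F F' : C ⥤ Vect} (α : F ⟶ F') {A A' : C} (ψ : A ⟶ A') (x : F.obj A) :
    vectHomEquiv _ _ (α.app A') (vectHomEquiv _ _ (F.map ψ) x) =
      vectHomEquiv _ _ (F'.map ψ) (vectHomEquiv _ _ (α.app A) x) :=
  LinearMap.congr_fun (congr_arg (vectHomEquiv _ _) (α.naturality ψ)) x

theorem vect_map_comp (X : C ⥤ Vect) {A B A' : C} (f : A ⟶ B) (g : B ⟶ A') (x : X.obj A) :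
    vectHomEquiv _ _ (X.map g) (vectHomEquiv _ _ (X.map f) x) =
      vectHomEquiv _ _ (X.map (f ≫ g)) x := by
  rw [X.map_comp]
  rfl

end NatTrans

/-! ### Induction from an automorphism group of a finite groupoid -/

section Induction

universe u w v
variable {C : Type u} [Category.{w} C] {a : C} {K : Type v} [Group K] (e : K ≃* Aut a)

/-- The endomorphism of `a` given by an element of `K ≃ Aut a`. -/
def actHom (k : K) : a ⟶ a := Iso.hom (e k)

theorem actHom_mul (k l : K) : actHom e (k * l) = actHom e l ≫ actHom e k :=
  congr_arg Iso.hom (map_mul e k l)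

theorem actHom_one : actHom e 1 = 𝟙 a :=
  congr_arg Iso.hom (map_one e)

theorem actHom_surjective [IsGroupoid C] : Function.Surjective (actHom e) := fun φ =>
  let ⟨k, hk⟩ := e.surjective (asIso φ)
  ⟨k, congr_arg Iso.hom hk⟩

theorem actHom_injective : Function.Injective (actHom e) := fun _ _ h =>
  e.injective (Iso.ext h)

/-- The value at `A` of the functor induced from a representation `V` of `K ≃ Aut a`: functions
`f` from the morphisms `a ⟶ A` to `V` with `f (k ≫ φ) = k⁻¹ • f φ`. It is zero unless `A` is
isomorphic to `a`. -/
def indSpace (V : FDRep ℂ K) (A : C) : Submodule ℂ ((a ⟶ A) → V) where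
  carrier := {f | ∀ k φ, V.ρ k (f (actHom e k ≫ φ)) = f φ}
  add_mem' hf hg k φ := by
    rw [Pi.add_apply, map_add, hf, hg, Pi.add_apply]
  zero_mem' k φ := map_zero _
  smul_mem' r f hf k φ := by
    rw [Pi.smul_apply, map_smul, hf, Pi.smul_apply]

variable {e}

theorem indSpace_apply {V : FDRep ℂ K} {A : C} (f : indSpace e V A) (k : K) (φ : a ⟶ A) :
    V.ρ k (f.1 (actHom e k ≫ φ)) = f.1 φ := f.2 k φ

/-- Postcomposition of equivariant functions with a morphism of representations. -/
noncomputable def indSpacePost {V W : FDRep ℂ K} (β : V ⟶ W) (A : C) :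
    indSpace e V A →ₗ[ℂ] indSpace e W A where
  toFun f := ⟨fun φ => fdRepHomEquiv V W β (f.1 φ), fun k φ => by
    rw [← Representation.IntertwiningMap.isIntertwining]
    exact congr_arg _ (indSpace_apply f k φ)⟩
  map_add' f g := by ext φ; exact map_add (fdRepHomEquiv V W β) _ _
  map_smul' r f := by ext φ; exact map_smul (fdRepHomEquiv V W β) _ _

theorem indSpacePost_apply {V W : FDRep ℂ K} (β : V ⟶ W) {A : C} (f : indSpace e V A)
    (φ : a ⟶ A) : (indSpacePost β A f).1 φ = fdRepHomEquiv V W β (f.1 φ) := rfl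

variable [IsGroupoid C]

/-- Transport of equivariant functions along a morphism, by precomposition with its inverse. -/
noncomputable def indSpaceMap (V : FDRep ℂ K) {A A' : C} (ψ : A ⟶ A') :
    indSpace e V A →ₗ[ℂ] indSpace e V A' where
  toFun f := ⟨fun φ => f.1 (φ ≫ inv ψ), fun k φ => by
    simpa only [Category.assoc] using indSpace_apply f k (φ ≫ inv ψ)⟩
  map_add' _ _ := rfl
  map_smul' _ _ := rfl

theorem indSpaceMap_apply {V : FDRep ℂ K} {A A' : C} (ψ : A ⟶ A') (f : indSpace e V A)
    (φ : a ⟶ A') : (indSpaceMap V ψ f).1 φ = f.1 (φ ≫ inv ψ) := rfl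

variable (e) [∀ A B : C, Finite (A ⟶ B)]

/-- The functor `C ⥤ Vect` induced from a representation of `K ≃ Aut a`. -/
noncomputable def indObj (V : FDRep ℂ K) : C ⥤ Vect where
  obj A := vectCopy (indSpace e V A)
  map {A A'} ψ := (vectHomEquiv _ _).symm ((vectCopyEquiv _).symm.toLinearMap ∘ₗ
    indSpaceMap V ψ ∘ₗ (vectCopyEquiv _).toLinearMap)
  map_id A := by
    refine (vectHomEquiv _ _).injective ?_
    ext x
    refine (LinearEquiv.symm_apply_eq _).2 (Subtype.ext (funext fun φ => ?_))
    refine (indSpaceMap_apply _ _ _).trans ?_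
    rw [IsIso.inv_id, Category.comp_id]
    rfl
  map_comp ψ ψ' := by
    refine (vectHomEquiv _ _).injective ?_
    ext x
    refine congr_arg (vectCopyEquiv _).symm (Subtype.ext (funext fun φ => ?_))
    refine Eq.trans ?_ (congr_arg (fun f => (indSpaceMap V ψ' f).1 φ)
      ((vectCopyEquiv _).apply_symm_apply _).symm)
    refine (indSpaceMap_apply _ _ _).trans ?_
    rw [IsIso.inv_comp, ← Category.assoc]
    rfl

/-- The values of `indObj` are spaces of equivariant functions. -/
noncomputable def indObjAux (V : FDRep ℂ K) (A : C) : (indObj e V).obj A ≃ₗ[ℂ] indSpace e V A :=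
  vectCopyEquiv _

variable {e}

theorem indObjAux_map {V : FDRep ℂ K} {A A' : C} (ψ : A ⟶ A') (x : (indObj e V).obj A) :
    indObjAux e V A' (vectHomEquiv _ _ ((indObj e V).map ψ) x) =
      indSpaceMap V ψ (indObjAux e V A x) :=
  (vectCopyEquiv _).apply_symm_apply _

variable (e) in
/-- Induction of representations of `K ≃ Aut a` to functors `C ⥤ Vect`. -/
noncomputable def ind : FDRep ℂ K ⥤ (C ⥤ Vect) where
  obj V := indObj e V
  map {V W} β := natTransMk
    (fun A => (indObjAux e W A).symm.toLinearMap ∘ₗ indSpacePost β A ∘ₗ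
      (indObjAux e V A).toLinearMap)
    (fun ψ x => by
      refine (indObjAux e W _).injective ?_
      rw [indObjAux_map]
      simp only [LinearMap.comp_apply, LinearEquiv.coe_coe, LinearEquiv.apply_symm_apply]
      rw [indObjAux_map]
      rfl)
  map_id V := natTrans_vect_ext fun A x => by
    rw [natTransMk_app]
    exact (LinearEquiv.symm_apply_eq _).2 rfl
  map_comp β γ := natTrans_vect_ext fun A x => by
    rw [natTransMk_app]
    refine congr_arg (indObjAux e _ A).symm (Subtype.ext (funext fun φ => ?_))
    exact congr_arg (fun f => (indSpacePost γ A f).1 φ)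
      ((indObjAux e _ A).apply_symm_apply (indSpacePost β A (indObjAux e _ A x))).symm

variable (e) in
/-- The values of an induced functor are spaces of equivariant functions, as in `indObjAux` but
stated for `ind`. -/
noncomputable def indObjEquiv (V : FDRep ℂ K) (A : C) :
    ((ind e).obj V).obj A ≃ₗ[ℂ] indSpace e V A :=
  indObjAux e V A

theorem indObjEquiv_map {V : FDRep ℂ K} {A A' : C} (ψ : A ⟶ A') (x : ((ind e).obj V).obj A) :
    indObjEquiv e V A' (vectHomEquiv _ _ (((ind e).obj V).map ψ) x) =
      indSpaceMap V ψ (indObjEquiv e V A x) :=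
  indObjAux_map ψ x

theorem indObjEquiv_ind_map {V W : FDRep ℂ K} (β : V ⟶ W) {A : C} (x : ((ind e).obj V).obj A) :
    indObjEquiv e W A (vectHomEquiv _ _ (((ind e).map β).app A) x) =
      indSpacePost β A (indObjEquiv e V A x) :=
  (indObjEquiv e W A).apply_symm_apply _

instance : (ind (C := C) e).Additive where
  map_add {V W β γ} := natTrans_vect_ext fun A x => by
    refine (indObjEquiv e W A).injective ((indObjEquiv_ind_map _ x).trans ?_)
    refine Eq.trans ?_ (map_add (indObjEquiv e W A)
      (vectHomEquiv _ _ (((ind e).map β).app A) x)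
      (vectHomEquiv _ _ (((ind e).map γ).app A) x)).symm
    rw [indObjEquiv_ind_map, indObjEquiv_ind_map]
    rfl

instance : (ind (C := C) e).Linear ℂ where
  map_smul {V W} β r := natTrans_vect_ext fun A x => by
    refine (indObjEquiv e W A).injective ((indObjEquiv_ind_map _ x).trans ?_)
    refine Eq.trans ?_ (map_smul (indObjEquiv e W A) r
      (vectHomEquiv _ _ (((ind e).map β).app A) x)).symm
    rw [indObjEquiv_ind_map]
    rfl

omit [∀ A B : C, Finite (A ⟶ B)] in
theorem indSpaceMap_actHom_one {V : FDRep ℂ K} (k : K) (f : indSpace e V a) :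
    (indSpaceMap V (actHom e k) f).1 (𝟙 a) = V.ρ k (f.1 (𝟙 a)) := by
  rw [indSpaceMap_apply, ← indSpace_apply f k, Category.id_comp, IsIso.hom_inv_id]

omit [∀ A B : C, Finite (A ⟶ B)] in
theorem indSpaceMap_inv_one {V : FDRep ℂ K} {A : C} (φ : a ⟶ A) (f : indSpace e V A) :
    (indSpaceMap V (inv φ) f).1 (𝟙 a) = f.1 φ := by
  rw [indSpaceMap_apply, Category.id_comp, IsIso.inv_inv]

omit [∀ A B : C, Finite (A ⟶ B)] in
theorem indSpace_ext_one {V : FDRep ℂ K} {f g : indSpace e V a} (h : f.1 (𝟙 a) = g.1 (𝟙 a)) :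
    f = g := by
  refine Subtype.ext (funext fun φ => ?_)
  obtain ⟨k, rfl⟩ := actHom_surjective e φ
  have hf := indSpace_apply f k (𝟙 a)
  have hg := indSpace_apply g k (𝟙 a)
  rw [Category.comp_id] at hf hg
  have hk (v : V) : V.ρ k⁻¹ (V.ρ k v) = v := by
    rw [← Module.End.mul_apply, ← map_mul, inv_mul_cancel, map_one, Module.End.one_apply]
  rw [← hk (f.1 _), ← hk (g.1 _), hf, hg, h]

/-- The equivariant function on `Aut a` with value `v` at the identity. -/
noncomputable def indConst (V : FDRep ℂ K) : V →ₗ[ℂ] indSpace e V a where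
  toFun v := ⟨fun φ => V.ρ (actHom_surjective e φ).choose⁻¹ v, fun k φ => by
    have h : (actHom_surjective e (actHom e k ≫ φ)).choose =
        (actHom_surjective e φ).choose * k := actHom_injective e <| by
      rw [actHom_mul, (actHom_surjective e _).choose_spec, (actHom_surjective e φ).choose_spec]
    dsimp only
    rw [h, ← Module.End.mul_apply, ← map_mul, mul_inv_rev, mul_inv_cancel_left]⟩
  map_add' v w := Subtype.ext (funext fun φ => map_add _ _ _)
  map_smul' r v := Subtype.ext (funext fun φ => map_smul _ _ _)

omit [∀ A B : C, Finite (A ⟶ B)] in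
theorem indConst_one (V : FDRep ℂ K) (v : V) : (indConst (e := e) V v).1 (𝟙 a) = v := by
  have h : (actHom_surjective e (𝟙 a)).choose = 1 := actHom_injective e <| by
    rw [(actHom_surjective e _).choose_spec, actHom_one]
  change V.ρ (actHom_surjective e (𝟙 a)).choose⁻¹ v = v
  rw [h, inv_one, map_one, Module.End.one_apply]

instance : (ind (C := C) e).Faithful where
  map_injective {V W β γ} h := by
    refine (fdRepHomEquiv V W).injective ?_
    ext v
    have key (β : V ⟶ W) : fdRepHomEquiv V W β v = (indObjEquiv e W a (vectHomEquiv _ _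
        (((ind e).map β).app a) ((indObjEquiv e V a).symm (indConst V v)))).1 (𝟙 a) := by
      rw [indObjEquiv_ind_map, LinearEquiv.apply_symm_apply, indSpacePost_apply, indConst_one]
    exact (key β).trans (h ▸ (key γ).symm)

/-- A morphism of induced functors is determined by its effect on the values at `𝟙 a` of the
equivariant functions on `Aut a`. -/
instance : (ind (C := C) e).Full where
  map_surjective {V W} α := by
    let T (A : C) : indSpace e V A →ₗ[ℂ] indSpace e W A := (indObjEquiv e W A).toLinearMap ∘ₗ
      vectHomEquiv _ _ (α.app A) ∘ₗ (indObjEquiv e V A).symm.toLinearMap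
    have hT {A A' : C} (ψ : A ⟶ A') (f : indSpace e V A) :
        T A' (indSpaceMap V ψ f) = indSpaceMap W ψ (T A f) := by
      obtain ⟨x, rfl⟩ := (indObjEquiv e V A).surjective f
      rw [← indObjEquiv_map]
      simp only [T, LinearMap.comp_apply, LinearEquiv.coe_coe, LinearEquiv.symm_apply_apply]
      exact (congr_arg (indObjEquiv e W A') (natTrans_naturality α ψ x)).trans
        (indObjEquiv_map ψ _)
    let β : Representation.IntertwiningMap V.ρ W.ρ :=
      { toLinearMap := LinearMap.proj (𝟙 a) ∘ₗ (indSpace e W a).subtype ∘ₗ T a ∘ₗ indConst V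
        isIntertwining' k := by
          ext v
          have h : indConst V (V.ρ k v) = indSpaceMap V (actHom e k) (indConst V v) :=
            indSpace_ext_one (by rw [indSpaceMap_actHom_one, indConst_one, indConst_one])
          change (T a (indConst V (V.ρ k v))).1 (𝟙 a) = W.ρ k ((T a (indConst V v)).1 (𝟙 a))
          rw [h, hT, indSpaceMap_actHom_one] }
    refine ⟨(fdRepHomEquiv V W).symm β, natTrans_vect_ext fun A x => ?_⟩
    refine (indObjEquiv e W A).injective ((indObjEquiv_ind_map _ x).trans ?_)
    have hx : indObjEquiv e W A (vectHomEquiv _ _ (α.app A) x) = T A (indObjEquiv e V A x) := by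
      simp [T]
    refine Eq.trans ?_ hx.symm
    refine Subtype.ext (funext fun φ => ?_)
    have h : indConst V ((indObjEquiv e V A x).1 φ) =
        indSpaceMap V (inv φ) (indObjEquiv e V A x) :=
      indSpace_ext_one (by rw [indSpaceMap_inv_one, indConst_one])
    change (T a (indConst V ((indObjEquiv e V A x).1 φ))).1 (𝟙 a) = _
    rw [h, hT, indSpaceMap_inv_one]

/-- Functors induced from non-isomorphic objects are orthogonal, having disjoint supports. -/
theorem ind_hom_eq_zero {a' : C} {K' : Type*} [Group K'] {e' : K' ≃* Aut a'}
    (h : IsEmpty (a ⟶ a')) {V : FDRep ℂ K} {W : FDRep ℂ K'} (α : (ind e).obj V ⟶ (ind e').obj W) :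
    α = 0 := natTrans_vect_ext fun A x => by
  by_cases hA : Nonempty (a ⟶ A)
  · refine (indObjEquiv e' W A).injective (Subtype.ext (funext fun φ => ?_))
    exact (h.false (hA.some ≫ inv φ)).elim
  · have : x = 0 := (indObjEquiv e V A).injective (Subtype.ext (funext fun φ => (hA ⟨φ⟩).elim))
    rw [this]
    exact (map_zero _).trans (map_zero _).symm

/-! ### Restriction to an automorphism group -/

section Restriction

variable (e) (X : C ⥤ Vect)

/-- The representation of `K ≃ Aut a` on `X a`. -/
noncomputable def res : FDRep ℂ K :=
  FDRep.of (V := X.obj a)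
    { toFun := fun k => vectHomEquiv _ _ (X.map (actHom e k))
      map_one' := by rw [actHom_one, X.map_id]; rfl
      map_mul' := fun k l => by rw [actHom_mul, X.map_comp]; rfl }

/-- The comparison map from a functor to the functor induced from its restriction. -/
noncomputable def indUnit : X ⟶ (ind e).obj (res e X) :=
  natTransMk (fun A => (indObjEquiv e (res e X) A).symm.toLinearMap ∘ₗ
    { toFun := fun x => ⟨fun φ => vectHomEquiv _ _ (X.map (inv φ)) x, fun k φ => by
        refine (vect_map_comp X _ _ _).trans ?_
        rw [IsIso.inv_comp, Category.assoc, IsIso.inv_hom_id, Category.comp_id]⟩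
      map_add' := fun x y => Subtype.ext (funext fun φ => map_add _ _ _)
      map_smul' := fun r x => Subtype.ext (funext fun φ => map_smul _ _ _) })
    (fun ψ x => by
      refine (indObjEquiv e (res e X) _).injective ?_
      refine ((indObjEquiv e (res e X) _).apply_symm_apply _).trans ?_
      refine Eq.trans ?_ (indObjEquiv_map ψ _).symm
      refine Eq.trans ?_ (congr_arg (indSpaceMap _ ψ)
        ((indObjEquiv e (res e X) _).apply_symm_apply _)).symm
      refine Subtype.ext (funext fun φ => ?_)
      refine (vect_map_comp X _ _ _).trans ?_
      simp [indSpaceMap])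

theorem indObjEquiv_indUnit {A : C} (x : X.obj A) (φ : a ⟶ A) :
    (indObjEquiv e (res e X) A (vectHomEquiv _ _ ((indUnit e X).app A) x)).1 φ =
      vectHomEquiv _ _ (X.map (inv φ)) x :=
  congr_arg (fun f => f.1 φ) ((indObjEquiv e (res e X) A).apply_symm_apply _)

end Restriction

end Induction

/-! ### Averaging over morphisms -/

section Averaging

universe u w v
variable {C : Type u} [Category.{w} C] {a : C} {K : Type v} [Group K] (e : K ≃* Aut a)
  [IsGroupoid C] [∀ A B : C, Finite (A ⟶ B)]

/-- The averaging map in the other direction sends an equivariant function `f` to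
`|K|⁻¹ ∑ φ, X(φ) (f φ)`. Its composite with `indUnit` is the identity at the objects isomorphic to
`a`, where `|Hom(a, A)| = |K|`, and zero at all others. -/
theorem exists_indUnit_comp (X : C ⥤ Vect) : ∃ ε : (ind e).obj (res e X) ⟶ X, ∀ A x,
    vectHomEquiv _ _ ((indUnit e X ≫ ε).app A) x =
      ((Nat.card K : ℂ)⁻¹ * Nat.card (a ⟶ A)) • x := by
  have (A : C) : Fintype (a ⟶ A) := Fintype.ofFinite _
  let τ (A : C) : ((ind e).obj (res e X)).obj A →ₗ[ℂ] X.obj A := (Nat.card K : ℂ)⁻¹ •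
    ∑ φ : a ⟶ A, vectHomEquiv _ _ (X.map φ) ∘ₗ LinearMap.proj φ ∘ₗ
      (indSpace e (res e X) A).subtype ∘ₗ (indObjEquiv e (res e X) A).toLinearMap
  have hτ (A : C) (x) : τ A x = (Nat.card K : ℂ)⁻¹ • ∑ φ : a ⟶ A,
      vectHomEquiv _ _ (X.map φ) ((indObjEquiv e (res e X) A x).1 φ) := by
    refine (LinearMap.smul_apply _ _ _).trans (congr_arg _ ?_)
    exact LinearMap.sum_apply _ _ _
  refine ⟨natTransMk τ fun {A A'} ψ x => ?_, fun A x => ?_⟩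
  · rw [hτ, hτ, map_smul, map_sum]
    congr 1
    let q : (a ⟶ A) ≃ (a ⟶ A') :=
      { toFun := fun φ => φ ≫ ψ
        invFun := fun φ => φ ≫ inv ψ
        left_inv := fun φ => by simp
        right_inv := fun φ => by simp }
    refine (Fintype.sum_equiv q _ _ fun φ => ?_).symm
    rw [indObjEquiv_map, indSpaceMap_apply]
    refine (vect_map_comp X φ ψ _).trans ?_
    simp [q]
  · rw [NatTrans.comp_app, vectHomEquiv_comp, LinearMap.comp_apply, natTransMk_app, hτ, mul_smul]
    congr 1
    have (φ : a ⟶ A) : vectHomEquiv _ _ (X.map φ) ((indObjEquiv e (res e X) A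
        (vectHomEquiv _ _ ((indUnit e X).app A) x)).1 φ) = x := by
      rw [indObjEquiv_indUnit]
      refine (vect_map_comp X _ _ _).trans ?_
      rw [IsIso.inv_hom_id, X.map_id]
      rfl
    rw [Fintype.sum_congr _ _ this, Finset.sum_const, Finset.card_univ, Nat.card_eq_fintype_card,
      Nat.cast_smul_eq_nsmul]

end Averaging

/-! ### Simple objects of the functor category of a finite groupoid -/

section Generation

universe w w' u₁ v₁ u₂ v₂

theorem map_mem_factorSpan {D : Type u₁} [Category.{v₁} D] [Preadditive D] [Linear ℂ D]
    {D' : Type u₂} [Category.{v₂} D'] [Preadditive D'] [Linear ℂ D'] {ι : Type w} {S : ι → D}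
    {ι' : Type w'} {S' : ι' → D'} (F : D ⥤ D') [F.Additive] [F.Linear ℂ] (l : ι → ι')
    (hl : ∀ i, F.obj (S i) = S' (l i)) {X Y : D} {f : X ⟶ Y} (hf : f ∈ factorSpan S X Y) :
    F.map f ∈ factorSpan S' (F.obj X) (F.obj Y) := by
  induction hf using Submodule.span_induction with
  | mem f hf =>
    obtain ⟨i, p, q, rfl⟩ := hf
    have : F.map (p ≫ q) = (F.map p ≫ eqToHom (hl i)) ≫ eqToHom (hl i).symm ≫ F.map q := by simp
    rw [this]
    exact comp_mem_factorSpan _ _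
  | zero => rw [F.map_zero]; exact zero_mem _
  | add f h _ _ hf hh => rw [F.map_add]; exact add_mem hf hh
  | smul r f _ hf => rw [F.map_smul]; exact Submodule.smul_mem _ _ hf

theorem IsSimpleGenerating.comp_equiv {D : Type u₁} [Category.{v₁} D] [Preadditive D]
    [Linear ℂ D] {ι : Type w} {S : ι → D} (hS : IsSimpleGenerating S) {ι' : Type w'}
    (l : ι' ≃ ι) : IsSimpleGenerating (fun i => S (l i)) where
  isSimpleObj i := hS.isSimpleObj _
  hom_eq_zero h f := hS.hom_eq_zero (l.injective.ne h) f
  id_mem X := by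
    have := map_mem_factorSpan (S' := fun i => S (l i)) (𝟭 D) l.symm
      (fun i => (congr_arg S (l.apply_symm_apply i)).symm) (hS.id_mem X)
    simpa using this

universe u v

/-- Representations of finite groupoids: for representatives `r c` of the isomorphism classes, the
functors induced from the irreducible representations of the groups `Aut (r c)` form a complete
system of simple objects of `C ⥤ Vect`. -/
theorem isSimpleGenerating_ind {C : Type u} [Category.{w} C] [IsGroupoid C]
    [∀ A B : C, Finite (A ⟶ B)] {γ : Type*} [Finite γ] {r : γ → C} {K : γ → Type v}
    [∀ c, Group (K c)] (e : ∀ c, K c ≃* Aut (r c)) (hr : ∀ A, ∃ c, Nonempty (r c ⟶ A))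
    (hr' : ∀ c c', c ≠ c' → IsEmpty (r c ⟶ r c')) :
    IsSimpleGenerating
      (fun i : Σ c, Irreps (K c) => (ind (e i.1)).obj (irrep i.2)) := by
  have hK (c : γ) : Finite (K c) := Finite.of_injective _ (actHom_injective (e c))
  refine ⟨fun i => ?_, fun {i j} hij α => ?_, fun X => ?_⟩
  · obtain ⟨s⟩ := isSimpleGenerating_irrep.isSimpleObj i.2
    exact ⟨(LinearEquiv.ofBijective ((ind (e i.1)).mapLinearMap ℂ)
      ⟨(ind (e i.1)).map_injective, (ind (e i.1)).map_surjective⟩).symm.trans s⟩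
  · by_cases h : i.1 = j.1
    · obtain ⟨c, i⟩ := i
      obtain ⟨c', j⟩ := j
      obtain rfl : c = c' := h
      obtain ⟨β, rfl⟩ := (ind (e c)).map_surjective α
      rw [isSimpleGenerating_irrep.hom_eq_zero (fun h => hij (congr_arg (Sigma.mk c) h)) β]
      exact (ind (e c)).map_zero _ _
    · exact ind_hom_eq_zero (hr' _ _ h) α
  · have := Fintype.ofFinite γ
    choose ε hε using fun c => exists_indUnit_comp (e c) X
    have hsum : 𝟙 X = ∑ c, indUnit (e c) X ≫ ε c := by
      refine natTrans_vect_ext fun A x => ?_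
      obtain ⟨c, ⟨φ⟩⟩ := hr A
      -- Only the representative `r c` isomorphic to `A` contributes, and `r c ⟶ A` is a torsor.
      have hcard : Nat.card (r c ⟶ A) = Nat.card (K c) :=
        Nat.card_congr (((Equiv.ofBijective _ ⟨actHom_injective (e c),
          actHom_surjective (e c)⟩).trans
          { toFun := fun χ => χ ≫ φ
            invFun := fun χ => χ ≫ inv φ
            left_inv := fun χ => by simp
            right_inv := fun χ => by simp }).symm)
      have happ : vectHomEquiv _ _ ((∑ c, indUnit (e c) X ≫ ε c).app A) x =
          ∑ c, vectHomEquiv _ _ ((indUnit (e c) X ≫ ε c).app A) x := by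
        rw [NatTrans.app_sum, map_sum, LinearMap.sum_apply]
      rw [happ, Finset.sum_eq_single c _ (by simp), hε, hcard,
        inv_mul_cancel₀ (Nat.cast_ne_zero.2 Nat.card_pos.ne'), one_smul]
      · rfl
      · intro c' _ hc
        have : IsEmpty (r c' ⟶ A) := ⟨fun ψ => (hr' c' c hc).false (ψ ≫ inv φ)⟩
        rw [hε, Nat.card_of_isEmpty (α := r c' ⟶ A), Nat.cast_zero, mul_zero, zero_smul]
    rw [hsum]
    refine sum_mem fun c _ => comp_left_mem_factorSpan _ ?_
    rw [← Category.id_comp (ε c), ← (ind (e c)).map_id]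
    refine comp_right_mem_factorSpan ?_ _
    exact map_mem_factorSpan (S' := fun i : Σ c, Irreps (K c) => (ind (e i.1)).obj (irrep i.2))
      (ind (e c)) (Sigma.mk c) (fun _ => rfl) (isSimpleGenerating_irrep.id_mem (res (e c) X))

end Generation

section Flat

universe u v
variable {G : Type v} [Group G] {B : Type u} [TopologicalSpace B] [PathConnectedSpace B]

/-- The identification of the gauge group of a flat connection with a subgroup of `G`. -/
noncomputable def autSubgroupEquiv (b : B) (A : FlatConnection G B) : autSubgroup b A ≃* Aut A :=
  (MonoidHom.ofInjective (gaugeEval_injective b A)).symm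

end Flat

end ExtendedTQFT

theorem mainTheorem12
    {E : Type*} [NormedAddCommGroup E] [NormedSpace ℝ E] [FiniteDimensional ℝ E]
    {H : Type*} [TopologicalSpace H] (I : ModelWithCorners ℝ E H) (k : WithTop ℕ∞)
    {B : Type*} [TopologicalSpace B] [T2Space B] [ChartedSpace H B] [IsManifold I k B]
    [CompactSpace B] [ConnectedSpace B]
    {G : Type*} [Group G] [Finite G] (b : B)
    (rep : ExtendedTQFT.GaugeClass G B → ExtendedTQFT.FlatConnection G B)
    (hrep : ∀ c, ExtendedTQFT.gaugeClass (rep c) = c) :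
    -- `Z_G(B)` is a KV 2-vector space
    ExtendedTQFT.IsKV2VectorSpace (ExtendedTQFT.ZG G B) ∧
    -- `Aut(A)` embeds in `G`
    (∀ A : ExtendedTQFT.FlatConnection G B, Function.Injective (ExtendedTQFT.gaugeEval b A)) ∧
    -- the sum below is a finite sum of finite numbers
    Finite (ExtendedTQFT.GaugeClass G B) ∧
    (∀ A : ExtendedTQFT.FlatConnection G B,
      Finite (ExtendedTQFT.Irreps (ExtendedTQFT.autSubgroup b A))) ∧
    -- `Z_G(B)` is equivalent to `Vect^n`
    ∃ e : ExtendedTQFT.ZG G B ≌ ExtendedTQFT.VectPow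
        (∑ᶠ c : ExtendedTQFT.GaugeClass G B,
          Nat.card (ExtendedTQFT.Irreps (ExtendedTQFT.autSubgroup b (rep c)))),
      e.functor.Additive ∧ e.functor.Linear ℂ := by
  have := I.stronglyLocallyContractibleSpace
  have : StronglyLocallyContractibleSpace B := ChartedSpace.stronglyLocallyContractibleSpace H B
  have : PathConnectedSpace B := .of_locallyPathConnectedSpace
  have hfin : Finite (ExtendedTQFT.GaugeClass G B) := ExtendedTQFT.finite_gaugeClass
  have := ExtendedTQFT.finite_gaugeTransformation (X := B) (G := G)
  have hS := ExtendedTQFT.isSimpleGenerating_ind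
    (fun c => ExtendedTQFT.autSubgroupEquiv b (rep c))
    (fun A => ⟨ExtendedTQFT.gaugeClass A, (Quotient.exact (hrep _)).map Iso.hom⟩)
    (fun c c' h => ⟨fun f => h <| by
      rw [← hrep c, ← hrep c']
      exact Quotient.sound ⟨asIso f⟩⟩)
  have := Fintype.ofFinite (ExtendedTQFT.GaugeClass G B)
  have hcard : Nat.card (Σ c, ExtendedTQFT.Irreps (ExtendedTQFT.autSubgroup b (rep c))) =
      ∑ᶠ c : ExtendedTQFT.GaugeClass G B,
        Nat.card (ExtendedTQFT.Irreps (ExtendedTQFT.autSubgroup b (rep c))) := by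
    rw [Nat.card_sigma, finsum_eq_sum_of_fintype]
  have : HasFiniteBiproducts (ExtendedTQFT.ZG G B) := .of_hasFiniteProducts
  have hS' := hS.comp_equiv (Finite.equivFinOfCardEq hcard).symm
  exact ⟨hS'.isKV2VectorSpace, ExtendedTQFT.gaugeEval_injective b, hfin,
    fun A => inferInstance, hS'.exists_equivalence⟩
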